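/- **Setting.** Let $\Omega\subset\mathbb R^d$ be compact and let $\lambda$ be a Borel probability measure on $\Omega$. Let $M$ be a second countable smooth $n$-dimensional manifold, with a metric $\rho$ that induces its topology (for instance a Riemannian distance), and let $N$ be a complete separable metric space. Consider the ensemble system $$\Sigma:\qquad \tfrac{d}{dt}x(t,\beta)=F\big(x(t,\beta),\beta,u(t)\big),\qquad Y_t=h\big(x(t,\Omega)\big),\qquad \beta\in\Omega,$$ where $F(\cdot,\beta,v)$ is a vector field on $M$ for every $\beta\in\Omega$ and $v\in\mathbb R^p$, the input $u$ (the same for all $\beta$) is taken from a given set $U_T$ of measurable functions $[0,T]\to\mathbb R^p$, and $h:M\to N$ is the output map. The state space $\mathcal F(\Omega,M)$ is the set of Borel maps $\Omega\to M$, with the metric (states that agree $\lambda$-a.e. being identified) $$d_F(f,g)=\int_\Omega\frac{\rho(f,g)}{1+\rho(f,g)}\,d\lambda .$$ An input $u\in U_T$ steers $x_0\in\mathcal F(\Omega,M)$ along $x$ if $x(t,\cdot)\in\mathcal F(\Omega,M)$ for all $t\in[0,T]$, $x(0,\cdot)=x_0$, and for every $\beta$ the curve $x(\cdot,\beta)$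 is absolutely continuous on $[0,T]$ and satisfies the equation for almost every $t\in[0,T]$. The output measure of a state $x$ is the push-forward $(h\circ x)_\#\lambda$. $\Sigma$ is *ensemble controllable* on $\mathcal F(\Omega,M)$ if for all $x_0,x_F\in\mathcal F(\Omega,M)$ and $\varepsilon>0$ there are $T>0$ and an input $u\in U_T$ that steers $x_0$ along some $x$ with $d_F(x(T,\cdot),x_F)<\varepsilon$. Let $\mathcal P$ be a set of Borel probability measures on $N$, and let $d_P$ be a metric on the space of all Borel probability measures on $N$. $\Sigma$ is *pattern controllable* on $\mathcal P$ if every $\mu_0\in\mathcal P$ is the output measure of some state and, for every state $x_0$ with output measure $\mu_0\in\mathcal P$, every $\mu_F\in\mathcal P$ and every $\varepsilon>0$, there are $T>0$ and an input $u\in U_T$ that steers $x_0$ along some $x$ with $d_P\big((h\circ x(T,\cdot))_\#\lambda,\mu_F\big)<\varepsilon$. **Theorem.** Suppose that $\Sigma$ is ensemble controllable on $\mathcal F(\Omega,M)$ and that $h:M\to N$ is continuous and surjective. Then, for every metric $d_P$ that induces the weak topology on the Borel probability measures on $N$: 1. $\Sigma$ is pattern controllable on the set $\{f_\#\lambda :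 f:\Omega\to N \text{ Borel}\}$; 2. if moreover $\lambda(\{\beta\})=0$ for every $\beta\in\Omega$, then $\Sigma$ is pattern controllable on the set $\mathcal P(N)$ of all Borel probability measures on $N$. -/

import Mathlib

open MeasureTheory Set
open scoped Manifold ContDiff

/-- The control system with aggregated measurements
`d/dt x(t,β) = F(x(t,β), β, u(t))`, `Y_t = h (x_t(Ω))`:
a family of controlled vector fields on the `n`-dimensional manifold `M`, indexed by `β ∈ Ω ⊆ ℝ^d`,
driven by one common `ℝ^p`-valued input, together with an output map `h : M → N`.
`controls T` is the set of admissible (measurable) inputs on the horizon `[0,T]`;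
only the values of an input on `[0,T]` are ever used. -/
structure EnsembleSystem {d : ℕ} (n p : ℕ) (Ω : Set (EuclideanSpace ℝ (Fin d)))
    (M N : Type*) [TopologicalSpace M] [ChartedSpace (EuclideanSpace ℝ (Fin n)) M]
    [MeasurableSpace M] [MeasurableSpace N] where
  /-- the right-hand side `F(x, β, u) ∈ T_x M` -/
  field : (x : M) → Ω → EuclideanSpace ℝ (Fin p) → TangentSpace (𝓡 n) x
  /-- the admissible inputs on `[0,T]` -/
  controls : ℝ → Set (ℝ → EuclideanSpace ℝ (Fin p))
  measurable_of_mem_controls : ∀ T, ∀ u ∈ controls T, Measurable u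
  /-- the output map `h` -/
  output : M → N
  measurable_output : Measurable output

/-- The state space `𝓕(Ω, M)` of the ensemble: Borel maps `Ω → M`. -/
abbrev EnsembleState {d : ℕ} (Ω : Set (EuclideanSpace ℝ (Fin d))) (M : Type*)
    [MeasurableSpace M] : Type _ :=
  {x : Ω → M // Measurable x}

/-- The metric `d_F(f, g) = ∫_Ω ρ(f,g) / (1 + ρ(f,g)) dλ` on `𝓕(Ω, M)`
(a metric once states that agree `λ`-almost everywhere are identified). -/
noncomputable def ensembleDist {d : ℕ} {Ω : Set (EuclideanSpace ℝ (Fin d))} (lam : Measure Ω)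
    {M : Type*} [MetricSpace M] [MeasurableSpace M] (f g : EnsembleState Ω M) : ℝ :=
  ∫ β, dist (f.1 β) (g.1 β) / (1 + dist (f.1 β) (g.1 β)) ∂lam

namespace EnsembleSystem

variable {d n p : ℕ} {Ω : Set (EuclideanSpace ℝ (Fin d))} {M N : Type*}

section Dynamics

variable [TopologicalSpace M] [ChartedSpace (EuclideanSpace ℝ (Fin n)) M]
  [MeasurableSpace M] [MeasurableSpace N]

/-- `γ` is, on `[0,T]`, a (Carathéodory) solution of `γ'(t) = F(γ(t), β, u(t))`: an absolutely
continuous curve in `M` (tested against smooth functions on `M`) that satisfies the equation for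
almost every `t ∈ [0,T]`. -/
def IsSolution (S : EnsembleSystem n p Ω M N) (T : ℝ) (u : ℝ → EuclideanSpace ℝ (Fin p)) (β : Ω)
    (γ : ℝ → M) : Prop :=
  ContinuousOn γ (Icc 0 T) ∧
  (∀ φ : M → ℝ, ContMDiff (𝓡 n) 𝓘(ℝ, ℝ) ∞ φ → AbsolutelyContinuousOnInterval (φ ∘ γ) 0 T) ∧
  ∀ᵐ t ∂(volume.restrict (Icc (0 : ℝ) T)),
    HasMFDerivAt 𝓘(ℝ, ℝ) (𝓡 n) γ t
      ((1 : ℝ →L[ℝ] ℝ).smulRight (S.field (γ t) β (u t)))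

/-- `t ↦ x t` is a trajectory in `𝓕(Ω, M)` of the ensemble on `[0,T]`, starting at `x₀` and driven
by the broadcast input `u`. Values of `x` outside `[0,T]` are irrelevant. -/
def IsTrajectory (S : EnsembleSystem n p Ω M N) (T : ℝ) (u : ℝ → EuclideanSpace ℝ (Fin p))
    (x₀ : EnsembleState Ω M) (x : ℝ → EnsembleState Ω M) : Prop :=
  x 0 = x₀ ∧ ∀ β : Ω, S.IsSolution T u β (fun t => (x t).1 β)

/-- The output measure `(h ∘ x)_# λ` of an ensemble state `x`. -/
noncomputable def outputMeasure (S : EnsembleSystem n p Ω M N) (lam : Measure Ω)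
    [IsProbabilityMeasure lam] (x : EnsembleState Ω M) : ProbabilityMeasure N :=
  ⟨lam.map (fun β => S.output (x.1 β)),
    Measure.isProbabilityMeasure_map (S.measurable_output.comp x.2).aemeasurable⟩

/-- Ensemble controllability on `𝓕(Ω, M)` with respect to `dF`. -/
def EnsembleControllable (S : EnsembleSystem n p Ω M N)
    (dF : EnsembleState Ω M → EnsembleState Ω M → ℝ) : Prop :=
  ∀ x₀ xF : EnsembleState Ω M, ∀ ε : ℝ, 0 < ε →
    ∃ T : ℝ, 0 < T ∧ ∃ u ∈ S.controls T, ∃ x : ℝ → EnsembleState Ω M,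
      S.IsTrajectory T u x₀ x ∧ dF (x T) xF < ε

/-- Pattern controllability on the set `P` of probability measures on `N`, with respect to `dP`:
every `μ₀ ∈ P` is the output measure of some ensemble state and, whichever state `x₀` with output
measure `μ₀` the ensemble starts from, some input steers the output measure to within `ε` of the
target `μF ∈ P` in finite time. -/
def PatternControllableOn (S : EnsembleSystem n p Ω M N) (lam : Measure Ω)
    [IsProbabilityMeasure lam] (P : Set (ProbabilityMeasure N))
    (dP : ProbabilityMeasure N → ProbabilityMeasure N → ℝ) : Prop :=
  ∀ μ₀ ∈ P, (∃ x₀ : EnsembleState Ω M, S.outputMeasure lam x₀ = μ₀) ∧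
    ∀ x₀ : EnsembleState Ω M, S.outputMeasure lam x₀ = μ₀ →
      ∀ μF ∈ P, ∀ ε : ℝ, 0 < ε →
        ∃ T : ℝ, 0 < T ∧ ∃ u ∈ S.controls T, ∃ x : ℝ → EnsembleState Ω M,
          S.IsTrajectory T u x₀ x ∧ dP (S.outputMeasure lam (x T)) μF < ε

end Dynamics

end EnsembleSystem

/-- The probability measures on `N` of the form `f_# λ` with `f : Ω → N` Borel. -/
def representableMeasures {d : ℕ} {Ω : Set (EuclideanSpace ℝ (Fin d))} (lam : Measure Ω)
    (N : Type*) [MeasurableSpace N] : Set (ProbabilityMeasure N) :=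
  {μ | ∃ f : Ω → N, Measurable f ∧ lam.map f = (μ : Measure N)}

/-- The topology of weak convergence on the Borel probability measures of `N`. -/
noncomputable abbrev weakTopology (N : Type*) [TopologicalSpace N] [MeasurableSpace N]
    [OpensMeasurableSpace N] : TopologicalSpace (ProbabilityMeasure N) :=
  inferInstance

/-- The metric `dP` on the probability measures of `N` induces the weak topology. -/
def IsWeakTopologyMetric {N : Type*} [TopologicalSpace N] [MeasurableSpace N]
    [OpensMeasurableSpace N] (dP : MetricSpace (ProbabilityMeasure N)) : Prop :=
  dP.toPseudoMetricSpace.toUniformSpace.toTopologicalSpace = weakTopology N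

open Filter Topology unitInterval

/-! A continuous surjection `h` from a `σ`-compact metric space has a Borel right inverse `s`
(`exists_measurable_rightInverse`), so a target `f_# λ` is the output measure of the state `s ∘ f`.
Ensemble controllability brings the terminal state `d_F`-close to `s ∘ f`. Along a sequence of
errors tending to 0, a subsequence of terminal states converges a.e.; continuity of `h` and
dominated convergence then give weak convergence of the output measures. If `λ` has no atoms, every
law on `N` is an image of `λ`, via the uniform law on `[0,1]`, so the second claim is an instance of
the first. -/

/-- Fibres are compact, so each nonempty one has a least point. Selecting it is Borel: on the range,
the points with selected value `≤ a` form the compact set `g (C ∩ (-∞, a])`. -/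
theorem exists_measurable_sInf_fiber {C : Set ℝ} (hC : IsCompact C) {N : Type*}
    [TopologicalSpace N] [T2Space N] [MeasurableSpace N] [OpensMeasurableSpace N]
    {g : C → N} (hg : Continuous g) :
    ∃ s : N → ℝ, Measurable s ∧ ∀ y ∈ range g, ∃ c : C, s y = c ∧ g c = y := by
  classical
  have : CompactSpace C := isCompact_iff_compactSpace.1 hC
  have hfib (y : N) : IsCompact (Subtype.val '' (g ⁻¹' {y})) :=
    ((isClosed_singleton.preimage hg).isCompact).image continuous_subtype_val
  have hmem (y : N) (hy : y ∈ range g) :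
      sInf (Subtype.val '' (g ⁻¹' {y})) ∈ Subtype.val '' (g ⁻¹' {y}) := by
    obtain ⟨c, rfl⟩ := hy
    exact (hfib _).sInf_mem ⟨c, c, rfl, rfl⟩
  have hrange : MeasurableSet (range g) := (isCompact_range hg).isClosed.measurableSet
  refine ⟨(range g).piecewise (fun y ↦ sInf (Subtype.val '' (g ⁻¹' {y}))) 0, ?_, ?_⟩
  · refine measurable_of_Iic fun a ↦ ?_
    have himage : MeasurableSet (g '' (Subtype.val ⁻¹' Iic a)) :=
      ((isClosed_Iic.preimage continuous_subtype_val).isCompact.image hg).isClosed.measurableSet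
    rw [piecewise_preimage]
    refine (MeasurableSet.ite hrange himage
      ((measurable_zero : Measurable (0 : N → ℝ)) (measurableSet_Iic (a := a)))).congr ?_
    ext y
    by_cases hy : y ∈ range g
    · simp only [Set.ite, mem_union, mem_inter_iff, hy, Set.mem_sdiff, not_true, and_true, and_false,
        or_false, mem_preimage, mem_Iic]
      constructor
      · rintro ⟨c, hc, rfl⟩
        exact (csInf_le (hfib _).bddBelow ⟨c, rfl, rfl⟩).trans hc
      · intro h
        obtain ⟨c, hc, hcs⟩ := hmem y hy
        exact ⟨c, by simpa [hcs] using h, hc⟩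
    · simp [Set.ite, hy]
  · intro y hy
    obtain ⟨c, hc, hcs⟩ := hmem y hy
    exact ⟨c, by simp [piecewise_eq_of_mem _ _ _ hy, hcs], hc⟩

/-- `K` is a continuous image of the Cantor set, whose order, inherited from `ℝ`, makes the
least-point selection available. -/
theorem IsCompact.exists_measurable_rightInvOn {M N : Type*} [MetricSpace M] [MeasurableSpace M]
    [BorelSpace M] [TopologicalSpace N] [T2Space N] [MeasurableSpace N] [OpensMeasurableSpace N]
    [Nonempty M] {K : Set M} (hK : IsCompact K) {h : M → N} (hh : Continuous h) :
    ∃ s : N → M, Measurable s ∧ ∀ y ∈ h '' K, h (s y) = y := by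
  obtain rfl | hne := K.eq_empty_or_nonempty
  · exact ⟨fun _ ↦ Classical.arbitrary M, measurable_const, by simp⟩
  have : CompactSpace K := isCompact_iff_compactSpace.1 hK
  have : Nonempty K := hne.to_subtype
  obtain ⟨f, hf, hfs⟩ := exists_nat_bool_continuous_surjective_of_compact K
  let q : cantorSet → M := fun c ↦ f (cantorSetHomeomorphNatToBool c)
  have hq : Continuous q :=
    continuous_subtype_val.comp (hf.comp cantorSetHomeomorphNatToBool.continuous)
  obtain ⟨s, hs, hsr⟩ := exists_measurable_sInf_fiber isCompact_cantorSet (hh.comp hq)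
  -- The selection `s` is real-valued, so `q` is extended to a Borel map on `ℝ` before composing.
  obtain ⟨r, hr, hrq⟩ := (MeasurableEmbedding.subtype_coe
    isClosed_cantorSet.measurableSet).exists_measurable_extend hq.measurable fun _ ↦ ‹Nonempty M›
  refine ⟨r ∘ s, hr.comp hs, ?_⟩
  rintro _ ⟨x, hx, rfl⟩
  obtain ⟨b, hb⟩ := hfs ⟨x, hx⟩
  obtain ⟨c, hc, hcx⟩ := hsr (h x) ⟨cantorSetHomeomorphNatToBool.symm b, by simp [q, hb]⟩
  have : r c = q c := congrFun hrq c
  simpa [hc, this] using hcx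

/-- A continuous surjection from a `σ`-compact metric space has a Borel right inverse. -/
theorem exists_measurable_rightInverse {M N : Type*} [MetricSpace M] [SigmaCompactSpace M]
    [MeasurableSpace M] [BorelSpace M] [TopologicalSpace N] [T2Space N] [MeasurableSpace N]
    [OpensMeasurableSpace N] {h : M → N} (hh : Continuous h) (hsurj : Function.Surjective h) :
    ∃ s : N → M, Measurable s ∧ Function.RightInverse s h := by
  classical
  obtain hN | ⟨⟨y₀⟩⟩ := isEmpty_or_nonempty N
  · exact ⟨fun y ↦ isEmptyElim y, measurable_of_empty _, fun y ↦ isEmptyElim y⟩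
  have : Nonempty M := ⟨(hsurj y₀).choose⟩
  choose s hs hsr using fun k ↦ (isCompact_compactCovering M k).exists_measurable_rightInvOn hh
  have hcov (y : N) : ∃ k, y ∈ h '' compactCovering M k := by
    obtain ⟨x, rfl⟩ := hsurj y
    obtain ⟨k, hk⟩ := exists_mem_compactCovering x
    exact ⟨k, x, hk, rfl⟩
  -- Glue by the first compact piece whose image contains `y`; these images are compact, hence
  -- Borel.
  exact ⟨fun y ↦ s (Nat.find (hcov y)) y, Measurable.find hs
    (fun k ↦ ((isCompact_compactCovering M k).image hh).isClosed.measurableSet) hcov,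
    fun y ↦ hsr _ _ (Nat.find_spec (hcov y))⟩

/-- The jump of the distribution function at a point is the mass of that point. -/
theorem ProbabilityTheory.continuous_cdf (ν : Measure ℝ) [IsProbabilityMeasure ν] [NullSingletonClass ν] :
    Continuous (ProbabilityTheory.cdf ν) := by
  refine continuous_iff_continuousAt.2 fun x ↦ ?_
  have hmono := ProbabilityTheory.monotone_cdf ν
  rw [hmono.continuousAt_iff_leftLim_eq_rightLim, StieltjesFunction.rightLim_eq]
  refine le_antisymm (hmono.leftLim_le le_rfl) ?_
  have := (ProbabilityTheory.cdf ν).measure_singleton x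
  rw [ProbabilityTheory.measure_cdf, measure_singleton, eq_comm, ENNReal.ofReal_eq_zero] at this
  linarith

/-- The distribution function of an atomless law on `ℝ` is uniformly distributed. -/
theorem ProbabilityTheory.measure_cdf_le (ν : Measure ℝ) [IsProbabilityMeasure ν] [NullSingletonClass ν]
    {t : ℝ} (h0 : 0 ≤ t) (h1 : t ≤ 1) : ν {x | ProbabilityTheory.cdf ν x ≤ t} = ENNReal.ofReal t := by
  -- The endpoints 0 and 1 need not be attained, so `t = 0` and `t = 1` need separate care.
  have hIVT {r : ℝ} (h0 : 0 < r) (h1 : r < 1) : ∃ x, ProbabilityTheory.cdf ν x = r :=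
    mem_range_of_exists_le_of_exists_ge (ProbabilityTheory.continuous_cdf ν)
      (((ProbabilityTheory.tendsto_cdf_atBot ν).eventually (ge_mem_nhds h0)).exists)
      (((ProbabilityTheory.tendsto_cdf_atTop ν).eventually (le_mem_nhds h1)).exists)
  obtain rfl | h1 := h1.eq_or_lt
  · simp [ProbabilityTheory.cdf_le_one]
  apply le_antisymm
  -- For `r` slightly above `t` and `cdf ν x = r`, monotonicity puts the set inside `Iic x`, of mass
  -- `r`.
  · refine le_of_forall_gt_imp_ge_of_dense fun b hb ↦ ?_
    obtain ⟨r, hr0, hrt, hrb⟩ : ∃ r : ℝ, t < r ∧ r < 1 ∧ ENNReal.ofReal r ≤ b := by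
      obtain rfl | hbt := eq_or_ne b ⊤
      · exact ⟨(t + 1) / 2, by linarith, by linarith, le_top⟩
      have : t < b.toReal := (ENNReal.ofReal_lt_iff_lt_toReal h0 hbt).1 hb
      obtain ⟨r, hr, hr'⟩ := exists_between (lt_min this h1)
      exact ⟨r, hr, (lt_min_iff.1 hr').2,
        ENNReal.ofReal_le_of_le_toReal (lt_min_iff.1 hr').1.le⟩
    obtain ⟨x, hx⟩ := hIVT (h0.trans_lt hr0) hrt
    refine le_trans (measure_mono fun z hz ↦ ?_)
      ((ProbabilityTheory.ofReal_cdf ν x).symm.trans_le (hx ▸ hrb))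
    by_contra hzx
    exact absurd ((ProbabilityTheory.monotone_cdf ν) (not_le.1 hzx).le)
      (not_le.2 (lt_of_le_of_lt hz (hx ▸ hr0)))
  · obtain rfl | h0 := h0.eq_or_lt
    · simp
    obtain ⟨x, hx⟩ := hIVT h0 h1
    subst hx
    rw [ProbabilityTheory.ofReal_cdf]
    exact measure_mono fun z hz ↦ ProbabilityTheory.monotone_cdf ν hz

/-- Embed `X` in `ℝ` and apply the distribution function of the image law, which is still atomless.
-/
theorem exists_measurable_map_eq_volume_unitInterval {X : Type*} [MeasurableSpace X]
    [StandardBorelSpace X] (μ : Measure X) [IsProbabilityMeasure μ] [NullSingletonClass μ] :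
    ∃ f : X → I, Measurable f ∧ μ.map f = volume := by
  have he := measurableEmbedding_embeddingReal X
  let ν := μ.map (embeddingReal X)
  have : IsProbabilityMeasure ν := Measure.isProbabilityMeasure_map he.measurable.aemeasurable
  have : NullSingletonClass ν := ⟨fun x ↦ by
    rw [he.map_apply]
    exact (subsingleton_singleton.preimage he.injective).measure_zero μ⟩
  let F : ℝ → I := fun x ↦
    ⟨ProbabilityTheory.cdf ν x, ProbabilityTheory.cdf_nonneg ν x, ProbabilityTheory.cdf_le_one ν x⟩
  have hF : Measurable F := (ProbabilityTheory.monotone_cdf ν).measurable.subtype_mk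
  refine ⟨F ∘ embeddingReal X, hF.comp he.measurable, ?_⟩
  rw [← Measure.map_map hF he.measurable]
  have : IsProbabilityMeasure (ν.map F) := Measure.isProbabilityMeasure_map hF.aemeasurable
  refine Measure.ext_of_Iic _ _ fun t ↦ ?_
  rw [Measure.map_apply hF measurableSet_Iic, unitInterval.volume_Iic]
  exact ProbabilityTheory.measure_cdf_le ν t.2.1 t.2.2

/-- Every law on a standard Borel space is the image of any atomless law. -/
theorem exists_measurable_map_eq_of_nullSingletonClass {X Y : Type*} [MeasurableSpace X]
    [StandardBorelSpace X] (μ : Measure X) [IsProbabilityMeasure μ] [NullSingletonClass μ]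
    [MeasurableSpace Y] [StandardBorelSpace Y] (ν : Measure Y) [IsProbabilityMeasure ν] :
    ∃ f : X → Y, Measurable f ∧ μ.map f = ν := by
  have : Nonempty Y := nonempty_of_isProbabilityMeasure ν
  obtain ⟨f, hf, hfμ⟩ := exists_measurable_map_eq_volume_unitInterval μ
  obtain ⟨g, hg, hgν⟩ := ν.exists_measurable_map_eq
  exact ⟨g ∘ f, hg.comp hf, by rw [← Measure.map_map hg hf, hfμ, hgν]⟩

/-- Convergence for the metric `∫ ρ(f, g) / (1 + ρ(f, g))` yields a.e. convergence along a
subsequence. -/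
theorem exists_seq_tendsto_ae_of_integral_dist_div {X M : Type*} [MeasurableSpace X]
    {μ : Measure X} [IsFiniteMeasure μ] [PseudoMetricSpace M] [SecondCountableTopology M]
    [MeasurableSpace M] [OpensMeasurableSpace M] {f : ℕ → X → M} {g : X → M}
    (hf : ∀ k, Measurable (f k)) (hg : Measurable g)
    (hfg : Tendsto (fun k ↦ ∫ x, dist (f k x) (g x) / (1 + dist (f k x) (g x)) ∂μ) atTop (𝓝 0)) :
    ∃ ns : ℕ → ℕ, StrictMono ns ∧
      ∀ᵐ x ∂μ, Tendsto (fun i ↦ f (ns i) x) atTop (𝓝 (g x)) := by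
  let q : ℕ → X → ℝ := fun k x ↦ dist (f k x) (g x) / (1 + dist (f k x) (g x))
  have hd (k : ℕ) : Measurable fun x ↦ dist (f k x) (g x) := (hf k).dist hg
  have hq (k : ℕ) : Measurable (q k) := (hd k).div (measurable_const.add (hd k))
  have hq0 (k : ℕ) (x : X) : 0 ≤ q k x := by positivity
  have hq1 (k : ℕ) (x : X) : q k x ≤ 1 := div_le_one_of_le₀ (by linarith) (by positivity)
  have hint (k : ℕ) : Integrable (q k) μ :=
    .of_bound (hq k).aestronglyMeasurable 1 (.of_forall fun x ↦ by
      rw [Real.norm_of_nonneg (hq0 k x)]; exact hq1 k x)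
  -- The hypothesis is `L¹` convergence of `q k` to 0.
  have hmeas : TendstoInMeasure μ q atTop 0 := by
    refine tendstoInMeasure_of_tendsto_eLpNorm one_ne_zero
      (fun k ↦ (hq k).aestronglyMeasurable) aestronglyMeasurable_zero ?_
    have h (k : ℕ) : eLpNorm (q k - 0) 1 μ = ENNReal.ofReal (∫ x, q k x ∂μ) := by
      rw [sub_zero, eLpNorm_one_eq_lintegral_enorm,
        ofReal_integral_eq_lintegral_ofReal (hint k) (.of_forall (hq0 k))]
      exact lintegral_congr fun x ↦ Real.enorm_of_nonneg (hq0 k x)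
    simp_rw [h]
    simpa using ENNReal.tendsto_ofReal hfg
  obtain ⟨ns, hns, hlim⟩ := hmeas.exists_seq_tendsto_ae
  refine ⟨ns, hns, hlim.mono fun x hx ↦ tendsto_iff_dist_tendsto_zero.2 ?_⟩
  -- `q ↦ q / (1 - q)` inverts `r ↦ r / (1 + r)` and is continuous at 0.
  have hx' : Tendsto (fun i ↦ q (ns i) x / (1 - q (ns i) x)) atTop (𝓝 (0 / (1 - 0))) :=
    hx.div (tendsto_const_nhds.sub hx) (by simp)
  simp only [sub_zero, zero_div] at hx'
  refine hx'.congr fun i ↦ ?_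
  have : (0 : ℝ) < 1 + dist (f (ns i) x) (g x) := by positivity
  simp only [q]
  field_simp
  simp

namespace EnsembleSystem

variable {d n p : ℕ} {Ω : Set (EuclideanSpace ℝ (Fin d))} {M N : Type*}

/-- The output measure depends continuously on the state, for a.e. convergence of states. -/
theorem tendsto_outputMeasure_of_ae [TopologicalSpace M]
    [ChartedSpace (EuclideanSpace ℝ (Fin n)) M] [MeasurableSpace M] [TopologicalSpace N]
    [MeasurableSpace N] [OpensMeasurableSpace N] (S : EnsembleSystem n p Ω M N)
    (lam : Measure Ω) [IsProbabilityMeasure lam] (hcont : Continuous S.output)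
    {x : ℕ → EnsembleState Ω M} {y : EnsembleState Ω M}
    (h : ∀ᵐ β ∂lam, Tendsto (fun k ↦ (x k).1 β) atTop (𝓝 (y.1 β))) :
    Tendsto (fun k ↦ S.outputMeasure lam (x k)) atTop (𝓝 (S.outputMeasure lam y)) := by
  rw [ProbabilityMeasure.tendsto_iff_forall_integral_tendsto]
  intro φ
  have hmeas (z : EnsembleState Ω M) : Measurable fun β ↦ S.output (z.1 β) :=
    S.measurable_output.comp z.2
  have hint (z : EnsembleState Ω M) :
      ∫ w, φ w ∂(S.outputMeasure lam z : Measure N) = ∫ β, φ (S.output (z.1 β)) ∂lam :=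
    integral_map (hmeas z).aemeasurable φ.continuous.measurable.aestronglyMeasurable
  simp_rw [hint]
  refine tendsto_integral_of_dominated_convergence (fun _ ↦ ‖φ‖)
    (fun k ↦ (φ.continuous.measurable.comp (hmeas (x k))).aestronglyMeasurable)
    (integrable_const _) (fun k ↦ .of_forall fun β ↦ φ.norm_coe_le_norm _) ?_
  filter_upwards [h] with β hβ
  exact ((φ.continuous.comp hcont).tendsto _).comp hβ

theorem exists_outputMeasure_eq [MetricSpace M] [SigmaCompactSpace M]
    [ChartedSpace (EuclideanSpace ℝ (Fin n)) M] [MeasurableSpace M] [BorelSpace M]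
    [TopologicalSpace N] [T2Space N] [MeasurableSpace N] [OpensMeasurableSpace N]
    (S : EnsembleSystem n p Ω M N) (lam : Measure Ω) [IsProbabilityMeasure lam]
    (hcont : Continuous S.output) (hsurj : Function.Surjective S.output)
    {μ : ProbabilityMeasure N} (hμ : μ ∈ representableMeasures lam N) :
    ∃ x : EnsembleState Ω M, S.outputMeasure lam x = μ := by
  obtain ⟨f, hf, hfμ⟩ := hμ
  obtain ⟨s, hs, hsr⟩ := exists_measurable_rightInverse hcont hsurj
  refine ⟨⟨s ∘ f, hs.comp hf⟩, Subtype.ext ?_⟩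
  simp only [outputMeasure, Function.comp_apply, hsr _]
  exact hfμ

theorem EnsembleControllable.exists_dist_outputMeasure_lt [MetricSpace M]
    [SecondCountableTopology M] [ChartedSpace (EuclideanSpace ℝ (Fin n)) M] [MeasurableSpace M]
    [BorelSpace M] [TopologicalSpace N] [MeasurableSpace N] [OpensMeasurableSpace N]
    {dP : MetricSpace (ProbabilityMeasure N)} (hdP : IsWeakTopologyMetric dP)
    {S : EnsembleSystem n p Ω M N} {lam : Measure Ω} [IsProbabilityMeasure lam]
    (hS : S.EnsembleControllable (ensembleDist lam)) (hcont : Continuous S.output)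
    (x₀ xF : EnsembleState Ω M) {ε : ℝ} (hε : 0 < ε) :
    ∃ T : ℝ, 0 < T ∧ ∃ u ∈ S.controls T, ∃ x : ℝ → EnsembleState Ω M,
      S.IsTrajectory T u x₀ x ∧
        dP.dist (S.outputMeasure lam (x T)) (S.outputMeasure lam xF) < ε := by
  -- Only the topology of `dP` is known, so there is no modulus to choose a single error from; a
  -- sequence is used, with horizons varying in `k`.
  choose T hT u hu x hx hdist using fun k : ℕ ↦ hS x₀ xF (1 / ((k : ℝ) + 1)) (by positivity)
  have hlim : Tendsto (fun k ↦ ensembleDist lam (x k (T k)) xF) atTop (𝓝 0) :=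
    squeeze_zero (fun k ↦ integral_nonneg fun β ↦ by positivity) (fun k ↦ (hdist k).le)
      tendsto_one_div_add_atTop_nhds_zero_nat
  obtain ⟨ns, -, hns⟩ := exists_seq_tendsto_ae_of_integral_dist_div
    (fun k ↦ (x k (T k)).2) xF.2 hlim
  have hout := S.tendsto_outputMeasure_of_ae lam hcont hns
  have hball : {μ | dP.dist μ (S.outputMeasure lam xF) < ε} ∈ 𝓝 (S.outputMeasure lam xF) := by
    change _ ∈ @nhds _ (weakTopology N) _
    rw [← hdP]
    exact @Metric.ball_mem_nhds _ dP.toPseudoMetricSpace _ _ hε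
  obtain ⟨k, hk⟩ := (hout.eventually hball).exists
  exact ⟨T (ns k), hT _, u _, hu _, x _, hx _, hk⟩

end EnsembleSystem


theorem mainTheorem1 {d n p : ℕ}
    (Ω : Set (EuclideanSpace ℝ (Fin d))) (hΩ : IsCompact Ω)
    (lam : Measure Ω) [IsProbabilityMeasure lam]
    {M : Type*} [MetricSpace M] [SecondCountableTopology M]
    [ChartedSpace (EuclideanSpace ℝ (Fin n)) M] [IsManifold (𝓡 n) ∞ M]
    [MeasurableSpace M] [BorelSpace M]
    {N : Type*} [MetricSpace N] [CompleteSpace N] [SecondCountableTopology N]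
    [MeasurableSpace N] [BorelSpace N]
    (dP : MetricSpace (ProbabilityMeasure N))
    (hdP : IsWeakTopologyMetric dP)
    (S : EnsembleSystem n p Ω M N)
    (hS : S.EnsembleControllable (ensembleDist lam))
    (hcont : Continuous S.output) (hsurj : Function.Surjective S.output) :
    S.PatternControllableOn lam (representableMeasures lam N) dP.dist ∧
    ((∀ β : Ω, lam {β} = 0) → S.PatternControllableOn lam univ dP.dist) := by
  -- With second countability this gives the `σ`-compactness that the right inverse requires.
  have : LocallyCompactSpace M := ChartedSpace.locallyCompactSpace (EuclideanSpace ℝ (Fin n)) M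
  have hrep : S.PatternControllableOn lam (representableMeasures lam N) dP.dist := by
    refine fun μ₀ hμ₀ ↦ ⟨S.exists_outputMeasure_eq lam hcont hsurj hμ₀, ?_⟩
    rintro x₀ - μF hμF ε hε
    obtain ⟨xF, rfl⟩ := S.exists_outputMeasure_eq lam hcont hsurj hμF
    exact hS.exists_dist_outputMeasure_lt hdP hcont x₀ xF hε
  refine ⟨hrep, fun hatom ↦ ?_⟩
  have : NullSingletonClass lam := ⟨hatom⟩
  have : StandardBorelSpace Ω := hΩ.isClosed.measurableSet.standardBorel
  have huniv : representableMeasures lam N = univ :=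
    eq_univ_of_forall fun μ ↦ exists_measurable_map_eq_of_nullSingletonClass lam (μ : Measure N)
  rwa [huniv] at hrep
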